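/- Call a category $\mathcal E$ a Grothendieck topos if it is equivalent to the category $\mathbf{Sh}(\mathcal C,J)$ of sheaves of sets on a small site $(\mathcal C,J)$. For a Grothendieck topos $\mathcal E$ let $\gamma_0\colon\mathbf{Set}\to\mathcal E$ be the constant sheaf functor, that is, the functor, unique up to isomorphism, that preserves small colimits and finite limits; it always has a right adjoint $\Gamma$, the global sections functor. The topos $\mathcal E$ is called completely connected if $\gamma_0$ has a left adjoint $\gamma_1\colon\mathcal E\to\mathbf{Set}$ which itself has a left adjoint $\gamma_2\colon\mathbf{Set}\to\mathcal E$, so that $\gamma_2\dashv\gamma_1\dashv\gamma_0\dashv\Gamma$. An object $c$ of a site $(\mathcal C,J)$ is called $J$-irreducible if the only $J$-covering sieve on $c$ is the maximal sieve, and the site is called completely connected if $\mathcal C$ has a $J$-irreducible initial object. Theorem. A Grothendieck topos $\mathcal E$ is completely connected if and only if there is a small completely connected site $(\mathcal C,J)$ such that $\mathcal E$ is equivalent to $\mathbf{Sh}(\mathcal C,J)$. -/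

import Mathlib

open CategoryTheory CategoryTheory.Limits

universe w v u

/-- A category `E` (with hom-sets in `Type w`) is a Grothendieck topos if it is equivalent to the
category of sheaves of sets on a small site. -/
def IsGrothendieckTopos (E : Type u) [Category.{w} E] : Prop :=
  ∃ (C : Type w) (_ : SmallCategory C) (J : GrothendieckTopology C),
    Nonempty (E ≌ Sheaf J (Type w))

/-- The characterisation of the constant sheaf functor `γ₀ : Set ⥤ E` of a Grothendieck topos `E`:
it is, up to isomorphism, the only functor that preserves small colimits and finite limits. -/
structure IsConstantSheafFunctor {E : Type u} [Category.{w} E] (F : Type w ⥤ E) : Prop where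
  preservesColimits : PreservesColimitsOfSize.{w, w} F
  preservesFiniteLimits : PreservesFiniteLimits F

/-- `E` is completely connected: there is a string of adjoint functors `γ₂ ⊣ γ₁ ⊣ γ₀ ⊣ Γ` between
`E` and the category of sets, where `γ₀` is the constant sheaf functor
(the last adjunction `γ₀ ⊣ Γ` holds in every Grothendieck topos). -/
def IsCompletelyConnected (E : Type u) [Category.{w} E] : Prop :=
  ∃ (γ₂ : Type w ⥤ E) (γ₁ : E ⥤ Type w) (γ₀ : Type w ⥤ E) (Γ : E ⥤ Type w),
    IsConstantSheafFunctor γ₀ ∧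
      Nonempty (γ₂ ⊣ γ₁) ∧ Nonempty (γ₁ ⊣ γ₀) ∧ Nonempty (γ₀ ⊣ Γ)

/-- An object `c` of a site is `J`-irreducible if the only `J`-covering sieve on `c` is the
maximal sieve. -/
def IsIrreducibleObject {C : Type u} [Category.{v} C] (J : GrothendieckTopology C) (c : C) : Prop :=
  ∀ S : Sieve c, S ∈ J c → S = ⊤

/-- A site `(C, J)` is completely connected if `C` has a `J`-irreducible initial object. -/
def IsCompletelyConnectedSite {C : Type u} [Category.{v} C] (J : GrothendieckTopology C) : Prop :=
  ∃ I : C, Nonempty (IsInitial I) ∧ IsIrreducibleObject J I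

/-! If `I` is initial and irreducible, every covering sieve on `X` contains `I ⟶ X`, so constant
presheaves are sheaves. Then `γ₀` is the constant functor, `γ₁` evaluation at `I`, and `γ₂` the
sheafification of the left adjoint of evaluation.

Conversely, put `P = γ₂ 1`. By adjunction a map `P ⟶ X` is an element of `γ₁ X`, so `P` has exactly
one map to each connected `X` (one with `γ₁ X = 1`). Since `γ₁ γ₀ ≅ id`, both `P` and the fibres of
the unit `X ⟶ γ₀ (γ₁ X)` over points are connected, and these fibres cover `X`. Hence `P` and the
components of the sheafified representables span a small dense full subcategory with `P` initial;
the comparison lemma, `sheafEquivOfIsCoverDense`, gives the site. As `γ₁` preserves jointly epic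
families, a covering sieve on `P` contains a split epimorphism, so `P` is irreducible. -/

open Opposite

/-! ### Dense subsites from locally full and locally faithful functors. -/

section DenseTopology

variable {D : Type*} [Category* D] {E : Type*} [Category* E]

/-- The largest topology on the target of `G` for which `G` lifts covers: a sieve covers `X` when
its pullback along each `x : G.obj d ⟶ X` contains the image of a covering sieve on `d`. -/
def coverLiftingTopology (K : GrothendieckTopology D) (G : D ⥤ E) : GrothendieckTopology E where
  sieves X := {S | ∀ (d : D) (x : G.obj d ⟶ X), (S.pullback x).functorPullback G ∈ K d}
  top_mem' X d x := by simp
  pullback_stable' X Y S f hS d x := by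
    rw [← Sieve.pullback_comp]
    exact hS d (x ≫ f)
  transitive' X S hS R hR d x := by
    refine K.transitive (hS d x) _ fun d' f hf => ?_
    have := hR hf d' (𝟙 _)
    refine K.superset_covering ?_ this
    intro d'' g hg
    simpa using hg

variable {K : GrothendieckTopology D} {G : D ⥤ E}

lemma functorPushforward_mem_coverLiftingTopology
    (hfull : ∀ {U V : D} (f : G.obj U ⟶ G.obj V), G.imageSieve f ∈ K U)
    {X : D} {S : Sieve X} (hS : S ∈ K X) :
    S.functorPushforward G ∈ coverLiftingTopology K G (G.obj X) := by
  intro d x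
  refine K.transitive (hfull x) _ fun d' f ⟨l, hl⟩ => ?_
  refine K.superset_covering ?_ (K.pullback_stable l hS)
  intro d'' g hg
  exact ⟨_, g ≫ l, 𝟙 _, hg, by simp [hl]⟩

/-- Meant for the sheafified Yoneda embedding, which is full and faithful only locally. -/
lemma isDenseSubsite_coverLiftingTopology
    (hfull : ∀ {U V : D} (f : G.obj U ⟶ G.obj V), G.imageSieve f ∈ K U)
    (hfaithful : ∀ {U V : D} (f g : U ⟶ V), G.map f = G.map g → Sieve.equalizer f g ∈ K U) :
    G.IsDenseSubsite K (coverLiftingTopology K G) where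
  isCoverDense' := ⟨fun U d x => K.superset_covering
    (fun _ f _ => ⟨⟨d, G.map f, x, rfl⟩⟩) (K.top_mem d)⟩
  isLocallyFull' := ⟨fun f => functorPushforward_mem_coverLiftingTopology hfull (hfull f)⟩
  isLocallyFaithful' := ⟨fun f g h =>
    functorPushforward_mem_coverLiftingTopology hfull (hfaithful f g h)⟩
  functorPushforward_mem_iff {X S} := by
    refine ⟨fun h => ?_, functorPushforward_mem_coverLiftingTopology hfull⟩
    refine K.transitive (h X (𝟙 _)) _ ?_
    rintro d f ⟨Y, g, k, hg, hk⟩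
    refine K.transitive (hfull k) _ ?_
    rintro d' f' ⟨l, hl⟩
    -- The two composites agree only after `G`, hence on a covering sieve.
    refine K.superset_covering ?_ (hfaithful (f' ≫ f) (l ≫ g) ?_)
    · intro d'' e he
      change e ≫ f' ≫ f = e ≫ l ≫ g at he
      change S ((e ≫ f') ≫ f)
      rw [Category.assoc, he, ← Category.assoc]
      exact S.downward_closed hg _
    · simp only [Category.comp_id] at hk
      simp [hl, hk]

end DenseTopology

/-! ### The topology on a sheaf category and the comparison lemma. -/

section SheafifiedYoneda

variable {D : Type w} [SmallCategory D] (K : GrothendieckTopology D)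

/-- The functor sending an object of a site to the sheaf associated to its representable presheaf. -/
noncomputable abbrev sheafifiedYoneda : D ⥤ Sheaf K (Type w) :=
  yoneda ⋙ presheafToSheaf K (Type w)

variable {K}

/-- Morphisms from a sheafified representable are sections. -/
noncomputable def sheafifiedYonedaEquiv {d : D} {X : Sheaf K (Type w)} :
    ((sheafifiedYoneda K).obj d ⟶ X) ≃ X.obj.obj (op d) :=
  ((sheafificationAdjunction K (Type w)).homEquiv _ _).trans yonedaEquiv

lemma sheafifiedYonedaEquiv_comp {d : D} {X Y : Sheaf K (Type w)}
    (x : (sheafifiedYoneda K).obj d ⟶ X) (g : X ⟶ Y) :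
    sheafifiedYonedaEquiv (x ≫ g) = g.hom.app _ (sheafifiedYonedaEquiv x) :=
  congrArg yonedaEquiv
    ((sheafificationAdjunction K (Type w)).homEquiv_naturality_right x g)

lemma sheafifiedYonedaEquiv_map_comp {d d' : D} {X : Sheaf K (Type w)} (f : d' ⟶ d)
    (x : (sheafifiedYoneda K).obj d ⟶ X) :
    sheafifiedYonedaEquiv ((sheafifiedYoneda K).map f ≫ x) =
      X.obj.map f.op (sheafifiedYonedaEquiv x) :=
  (congrArg yonedaEquiv
    ((sheafificationAdjunction K (Type w)).homEquiv_naturality_left (yoneda.map f) x)).trans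
      (yonedaEquiv_naturality _ _).symm

lemma sheafifiedYonedaEquiv_map {d d' : D} (f : d' ⟶ d) :
    sheafifiedYonedaEquiv ((sheafifiedYoneda K).map f) =
      (toSheafify K (yoneda.obj d)).app (op d') f := by
  rw [← Category.comp_id ((sheafifiedYoneda K).map f), sheafifiedYonedaEquiv_map_comp]
  exact map_yonedaEquiv _ f

lemma imageSieve_sheafifiedYoneda_mem {U V : D}
    (f : (sheafifiedYoneda K).obj U ⟶ (sheafifiedYoneda K).obj V) :
    (sheafifiedYoneda K).imageSieve f ∈ K U := by
  refine K.superset_covering ?_ (Presheaf.imageSieve_mem K (toSheafify K (yoneda.obj V))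
    (U := op U) (sheafifiedYonedaEquiv f))
  rintro W g ⟨l, hl⟩
  refine ⟨l, sheafifiedYonedaEquiv.injective ?_⟩
  rw [sheafifiedYonedaEquiv_map, sheafifiedYonedaEquiv_map_comp]
  exact hl

lemma equalizer_mem_of_sheafifiedYoneda_map_eq {U V : D} (f g : U ⟶ V)
    (h : (sheafifiedYoneda K).map f = (sheafifiedYoneda K).map g) :
    Sieve.equalizer f g ∈ K U := by
  refine Presheaf.equalizerSieve_mem K (toSheafify K (yoneda.obj V)) (X := op U) f g ?_
  rw [← sheafifiedYonedaEquiv_map, ← sheafifiedYonedaEquiv_map, h]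

variable (K) in
/-- The topology on a category of sheaves whose covers are the jointly locally surjective sieves. -/
noncomputable abbrev locallySurjectiveTopology : GrothendieckTopology (Sheaf K (Type w)) :=
  coverLiftingTopology K (sheafifiedYoneda K)

instance : (sheafifiedYoneda K).IsDenseSubsite K (locallySurjectiveTopology K) :=
  isDenseSubsite_coverLiftingTopology imageSieve_sheafifiedYoneda_mem
    equalizer_mem_of_sheafifiedYoneda_map_eq

/-- Every category of sheaves on a small site is equivalent to the sheaves on any small dense
subcategory of itself. -/
noncomputable def sheafEquivOfIsCoverDense {C : Type w} [SmallCategory C]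
    (F : C ⥤ Sheaf K (Type w)) [F.Full] [F.Faithful]
    [F.IsCoverDense (locallySurjectiveTopology K)] :
    Sheaf K (Type w) ≌ Sheaf (F.inducedTopology (locallySurjectiveTopology K)) (Type w) :=
  (Functor.IsDenseSubsite.sheafEquiv K (locallySurjectiveTopology K) (sheafifiedYoneda K)
    (Type w)).trans
    (F.sheafInducedTopologyEquivOfIsCoverDense (locallySurjectiveTopology K) (Type w)).symm

/-- Morphisms out of a sheaf are determined by their restrictions to a covering sieve. -/
lemma hom_ext_of_mem_locallySurjectiveTopology {X Y : Sheaf K (Type w)} {S : Sieve X}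
    (hS : S ∈ locallySurjectiveTopology K X) {f g : X ⟶ Y}
    (h : ∀ ⦃Z : Sheaf K (Type w)⦄ (k : Z ⟶ X), S k → k ≫ f = k ≫ g) : f = g := by
  ext ⟨d⟩ s
  obtain ⟨x, rfl⟩ := sheafifiedYonedaEquiv.surjective s
  refine (((isSheaf_iff_isSheaf_of_type _ _).1 Y.property) _ (hS d x)).isSeparatedFor.ext ?_
  intro d' k hk
  have := congrArg sheafifiedYonedaEquiv (h _ hk)
  rw [Category.assoc, Category.assoc, sheafifiedYonedaEquiv_map_comp,
    sheafifiedYonedaEquiv_map_comp, sheafifiedYonedaEquiv_comp, sheafifiedYonedaEquiv_comp] at this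
  exact this

/-- A sieve on a sheaf is covering as soon as it is jointly epimorphic. -/
lemma mem_locallySurjectiveTopology_of_hom_ext {X : Sheaf K (Type w)} {S : Sieve X}
    (hS : ∀ ⦃Y : Sheaf K (Type w)⦄ (f g : X ⟶ Y),
      (∀ ⦃Z : Sheaf K (Type w)⦄ (k : Z ⟶ X), S k → k ≫ f = k ≫ g) → f = g) :
    S ∈ locallySurjectiveTopology K X := by
  let R : Subfunctor X.obj :=
    { obj U := {s | S (sheafifiedYonedaEquiv (d := unop U).symm s)}
      map {U V} i s hs := by
        change S _
        have : sheafifiedYonedaEquiv.symm (X.obj.map i s) =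
            (sheafifiedYoneda K).map i.unop ≫ sheafifiedYonedaEquiv.symm s := by
          rw [Equiv.symm_apply_eq, sheafifiedYonedaEquiv_map_comp, Equiv.apply_symm_apply]
          rfl
        rw [this]
        exact S.downward_closed hs _ }
  -- `X'` is the subsheaf of `X` generated by the sections in `S`; joint epimorphy makes its
  -- inclusion epi, hence locally surjective.
  let X' : Sheaf K (Type w) := ⟨(R.sheafify K).toFunctor,
    (isSheaf_iff_isSheaf_of_type _ _).2
      (R.sheafify_isSheaf ((isSheaf_iff_isSheaf_of_type _ _).1 X.property))⟩
  let ι : X' ⟶ X := ⟨(R.sheafify K).ι⟩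
  have hepi : Epi ι := ⟨fun {Y} f g hfg => hS f g fun Z k hk => by
    ext ⟨d⟩ z
    have hz : k.hom.app (op d) z ∈ (R.sheafify K).obj (op d) := by
      refine R.le_sheafify K _ ?_
      change S _
      obtain ⟨z, rfl⟩ := sheafifiedYonedaEquiv.surjective z
      rw [← sheafifiedYonedaEquiv_comp, Equiv.symm_apply_apply]
      exact S.downward_closed hk _
    exact congrArg (fun a : X' ⟶ Y => a.hom.app (op d) ⟨_, hz⟩) hfg⟩
  have hsurj : Sheaf.IsLocallySurjective ι := (Sheaf.isLocallySurjective_iff_epi ι).2 hepi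
  intro d x
  refine K.transitive (Presheaf.imageSieve_mem K ι.hom (U := op d) (sheafifiedYonedaEquiv x)) _ ?_
  rintro d' f ⟨⟨t, ht⟩, rfl : t = _⟩
  refine K.superset_covering ?_ ht
  intro d'' g hg
  change S ((sheafifiedYoneda K).map (g ≫ f) ≫ x)
  change S (sheafifiedYonedaEquiv.symm (X.obj.map g.op (X.obj.map f.op _))) at hg
  rwa [← sheafifiedYonedaEquiv_map_comp, ← sheafifiedYonedaEquiv_map_comp,
    Equiv.symm_apply_apply, ← Category.assoc, ← Functor.map_comp] at hg

end SheafifiedYoneda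

/-! ### From a completely connected site to the adjoint string. -/

section IrreducibleInitial

variable {C : Type w} [SmallCategory C] {J : GrothendieckTopology C}

/-- Evaluation of presheaves at an initial object is left adjoint to the constant presheaf. -/
def evaluationInitialAdjunction {I : C} (hI : IsInitial I) :
    (evaluation Cᵒᵖ (Type w)).obj (op I) ⊣ Functor.const Cᵒᵖ where
  unit.app F :=
    { app X := F.map (hI.to (unop X)).op
      naturality X Y f := by
        have : hI.to (unop X) = hI.to (unop Y) ≫ f.unop := hI.hom_ext _ _
        rw [this, op_comp, Functor.map_comp]
        rfl }
  counit.app A := 𝟙 A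
  left_triangle_components F := by
    simp

/-- Over an irreducible initial object, constant presheaves are sheaves. -/
lemma isSheaf_const_of_isIrreducibleObject {I : C} (hI : IsInitial I)
    (hirr : IsIrreducibleObject J I) (A : Type w) :
    Presheaf.IsSheaf J ((Functor.const Cᵒᵖ).obj A) := by
  rw [isSheaf_iff_isSheaf_of_type]
  intro X S hS x hx
  have hmem : S (hI.to X) := by
    have h := hirr _ (J.pullback_stable (hI.to X) hS)
    have : S.pullback (hI.to X) (𝟙 I) := by rw [h]; trivial
    simpa using this
  let y : A := x (hI.to X) hmem
  refine ⟨y, fun Y f hf => ?_, fun y hy => hy (hI.to X) hmem⟩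
  exact (hx (hI.to Y) (𝟙 I) hf hmem (hI.hom_ext _ _)).symm

/-- Sheaves on a site with an irreducible initial object form a completely connected topos. -/
lemma isCompletelyConnected_sheaf (h : IsCompletelyConnectedSite J) :
    IsCompletelyConnected.{w} (Sheaf J (Type w)) := by
  obtain ⟨I, ⟨hI⟩, hirr⟩ := h
  let γ₀ : Type w ⥤ Sheaf J (Type w) :=
    ObjectProperty.lift _ (Functor.const Cᵒᵖ) (isSheaf_const_of_isIrreducibleObject hI hirr)
  let γ₁ : Sheaf J (Type w) ⥤ Type w :=
    sheafToPresheaf J (Type w) ⋙ (evaluation Cᵒᵖ (Type w)).obj (op I)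
  let adj₂ := (evaluationAdjunctionRight (Type w) (op I)).comp (sheafificationAdjunction J (Type w))
  let adj₁ : γ₁ ⊣ γ₀ := (evaluationInitialAdjunction hI).restrictFullyFaithful
    (fullyFaithfulSheafToPresheaf J (Type w)) (Functor.FullyFaithful.id (Type w))
    (Iso.refl _) (Iso.refl _)
  let adj₀ : γ₀ ⊣ sheafToPresheaf J (Type w) ⋙ lim :=
    (constLimAdj (J := Cᵒᵖ) (C := Type w)).restrictFullyFaithful
      (Functor.FullyFaithful.id (Type w)) (fullyFaithfulSheafToPresheaf J (Type w))
      (Iso.refl _) (Iso.refl _)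
  exact ⟨_, γ₁, γ₀, _, ⟨adj₀.leftAdjoint_preservesColimits,
    ⟨fun _ _ _ => adj₁.rightAdjoint_preservesLimits.preservesLimitsOfShape⟩⟩,
    ⟨adj₂⟩, ⟨adj₁⟩, ⟨adj₀⟩⟩

end IrreducibleInitial

lemma IsCompletelyConnected.of_equivalence {E : Type u} [Category.{w} E] {E' : Type v}
    [Category.{w} E'] (e : E ≌ E') (h : IsCompletelyConnected.{w} E') :
    IsCompletelyConnected.{w} E := by
  obtain ⟨γ₂, γ₁, γ₀, Γ, -, ⟨adj₂⟩, ⟨adj₁⟩, ⟨adj₀⟩⟩ := h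
  let adj₁' := e.toAdjunction.comp adj₁
  let adj₀' := adj₀.comp e.symm.toAdjunction
  exact ⟨_, _, _, _, ⟨adj₀'.leftAdjoint_preservesColimits,
    ⟨fun _ _ _ => adj₁'.rightAdjoint_preservesLimits.preservesLimitsOfShape⟩⟩,
    ⟨adj₂.comp e.symm.toAdjunction⟩, ⟨adj₁'⟩, ⟨adj₀'⟩⟩

/-! ### Connected objects and components. -/

section AdjointString

/-- Morphisms out of `L.obj A`, for `L` a left adjoint, are determined on the points of `A`. -/
lemma CategoryTheory.Adjunction.hom_ext_points {E : Type u} [Category.{v} E] {L : Type w ⥤ E}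
    {R : E ⥤ Type w} (adj : L ⊣ R) {A : Type w} {Z : E} {g h : L.obj A ⟶ Z}
    (H : ∀ a : A, L.map (↾fun _ : PUnit.{w + 1} => a) ≫ g =
      L.map (↾fun _ : PUnit.{w + 1} => a) ≫ h) : g = h := by
  refine (adj.homEquiv _ _).injective ?_
  ext a
  have := congrArg (adj.homEquiv _ _) (H a)
  rw [adj.homEquiv_naturality_left, adj.homEquiv_naturality_left] at this
  exact ConcreteCategory.congr_hom this PUnit.unit

/-- A jointly epimorphic family of maps of types is jointly surjective. -/
lemma exists_apply_eq_of_hom_ext {A : Type w} {ι : Sort*} {B : ι → Type w} (f : ∀ i, B i ⟶ A)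
    (hf : ∀ g h : A ⟶ ULift.{w} Prop, (∀ i, f i ≫ g = f i ≫ h) → g = h) (a : A) :
    ∃ i b, f i b = a := by
  -- Compare the characteristic map of the joint image with the constant map true.
  have := hf (↾fun a => ULift.up (∃ i b, f i b = a)) (↾fun _ => ULift.up True) fun i => by
    ext b
    exact iff_true_intro ⟨i, b, rfl⟩
  exact of_eq_true (congrArg ULift.down (ConcreteCategory.congr_hom this a))

variable {E : Type u} [Category.{w} E] {γ₂ : Type w ⥤ E} {γ₁ : E ⥤ Type w} {γ₀ : Type w ⥤ E}
  {Γ : E ⥤ Type w} (adj₂ : γ₂ ⊣ γ₁) (adj₁ : γ₁ ⊣ γ₀) (adj₀ : γ₀ ⊣ Γ)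

include adj₂ adj₁ in
lemma nonempty_unique_map_constant_punit :
    Nonempty (Unique (γ₁.obj (γ₀.obj PUnit.{w + 1}))) := by
  have : PreservesLimitsOfSize.{0, 0} γ₁ := adj₂.rightAdjoint_preservesLimits
  have : PreservesLimitsOfSize.{0, 0} γ₀ := adj₁.rightAdjoint_preservesLimits
  have h : IsTerminal (γ₁.obj (γ₀.obj PUnit.{w + 1})) :=
    (Types.isTerminalPUnit.isTerminalObj γ₀).isTerminalObj γ₁
  exact ⟨((Types.isTerminalEquivUnique _) h)⟩

include adj₂ adj₀ in
-- The composite `γ₁ γ₀` is a left adjoint fixing the one-point set, and every set is the coproduct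
-- of its points.
lemma isIso_counit_of_adjoint_string : IsIso adj₁.counit := by
  obtain ⟨hu⟩ := nonempty_unique_map_constant_punit adj₂ adj₁
  have : ∀ A, IsIso (adj₁.counit.app A) := fun A => by
    have key (a : A) (p : γ₁.obj (γ₀.obj PUnit.{w + 1})) :
        adj₁.counit.app A (γ₁.map (γ₀.map (↾fun _ : PUnit.{w + 1} => a)) p) = a :=
      ConcreteCategory.congr_hom (adj₁.counit.naturality (↾fun _ : PUnit.{w + 1} => a)) p
    have surj (x : γ₁.obj (γ₀.obj A)) :
        ∃ (a : A) (p : _), γ₁.map (γ₀.map (↾fun _ : PUnit.{w + 1} => a)) p = x :=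
      exists_apply_eq_of_hom_ext
        (fun a : A => γ₁.map (γ₀.map (↾fun _ : PUnit.{w + 1} => a)))
        (fun g h H => (adj₀.comp adj₁).hom_ext_points H) x
    rw [isIso_iff_bijective]
    refine ⟨fun x y hxy => ?_, fun a => ⟨_, key a default⟩⟩
    obtain ⟨a, p, rfl⟩ := surj x
    obtain ⟨b, q, rfl⟩ := surj y
    rw [key, key] at hxy
    rw [hxy, Subsingleton.elim p q]
  exact NatIso.isIso_of_isIso_app _

include adj₂ in
/-- The point `γ₂ 1` of a completely connected topos is sent to a point by `γ₁`. -/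
lemma nonempty_unique_map_leftAdjoint_punit [IsIso adj₁.counit] :
    Nonempty (Unique (γ₁.obj (γ₂.obj PUnit.{w + 1}))) := by
  let t : Adjunction.Triple γ₂ γ₁ γ₀ := ⟨adj₂, adj₁⟩
  have : IsIso adj₂.unit := t.isIso_unit_iff_isIso_counit.2 ‹_›
  exact ⟨(equivEquivIso.symm (asIso (adj₂.unit.app PUnit.{w + 1}))).symm.unique (β := PUnit)⟩

/-- The connected component of `X` indexed by `a`. -/
noncomputable abbrev component [HasPullbacks E] (X : E) (a : γ₁.obj X) : E :=
  pullback (adj₁.unit.app X) (γ₀.map (↾fun _ : PUnit.{w + 1} => a))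

include adj₂ in
-- `γ₁` preserves the pullback defining the component and inverts the unit, so the value is that of
-- `γ₁ γ₀` at a point.
lemma nonempty_unique_map_component [HasPullbacks E] [IsIso adj₁.counit] (X : E) (a : γ₁.obj X) :
    Nonempty (Unique (γ₁.obj (component adj₁ X a))) := by
  obtain ⟨hu⟩ := nonempty_unique_map_constant_punit adj₂ adj₁
  have : PreservesLimitsOfSize.{0, 0} γ₁ := adj₂.rightAdjoint_preservesLimits
  have hp := (IsPullback.of_hasPullback (adj₁.unit.app X)
    (γ₀.map (↾fun _ : PUnit.{w + 1} => a))).map γ₁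
  have : IsIso (γ₁.map (adj₁.unit.app X)) := by
    have h := adj₁.left_triangle_components X
    exact isIso_of_comp_hom_eq_id _ h
  have := hp.isIso_snd_of_isIso
  exact ⟨(equivEquivIso.symm (asIso (γ₁.map (pullback.snd (adj₁.unit.app X)
    (γ₀.map (↾fun _ : PUnit.{w + 1} => a)))))).unique⟩

end AdjointString

/-! ### The site of connected generators. -/

section ConnectedSite

variable {D : Type w} [SmallCategory D] {K : GrothendieckTopology D}
  {γ₂ : Type w ⥤ Sheaf K (Type w)} {γ₁ : Sheaf K (Type w) ⥤ Type w}
  {γ₀ : Type w ⥤ Sheaf K (Type w)} {Γ : Sheaf K (Type w) ⥤ Type w}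
  (adj₂ : γ₂ ⊣ γ₁) (adj₁ : γ₁ ⊣ γ₀) (adj₀ : γ₀ ⊣ Γ)

include adj₀ in
/-- The connected components of a sheaf cover it. -/
lemma ofArrows_component_mem (X : Sheaf K (Type w)) :
    Sieve.ofArrows (component adj₁ X) (fun _ => pullback.fst _ _) ∈
      locallySurjectiveTopology K X := by
  have h : Sieve.ofArrows (fun _ : γ₁.obj X => γ₀.obj PUnit.{w + 1})
      (fun a => γ₀.map (↾fun _ : PUnit.{w + 1} => a)) ∈
        locallySurjectiveTopology K (γ₀.obj (γ₁.obj X)) :=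
    mem_locallySurjectiveTopology_of_hom_ext fun Y f g H =>
      adj₀.hom_ext_points fun a => H _ (Sieve.ofArrows_mk _ _ a)
  refine GrothendieckTopology.superset_covering _ ?_
    ((locallySurjectiveTopology K).pullback_stable (adj₁.unit.app X) h)
  intro Z k hk
  obtain ⟨W, p, _, ⟨a⟩, hp⟩ := hk
  exact ⟨_, pullback.lift k p hp.symm, _, ⟨a⟩, pullback.lift_fst _ _ _⟩

include adj₂ adj₁ in
/-- Every covering sieve of the object corepresenting `γ₁` contains a split epimorphism. -/
lemma exists_section_of_mem_locallySurjectiveTopology [IsIso adj₁.counit]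
    {S : Sieve (γ₂.obj PUnit.{w + 1})}
    (hS : S ∈ locallySurjectiveTopology K (γ₂.obj PUnit.{w + 1})) :
    ∃ (Z : Sheaf K (Type w)) (k : Z ⟶ γ₂.obj PUnit.{w + 1}) (s : γ₂.obj PUnit.{w + 1} ⟶ Z),
      S k ∧ s ≫ k = 𝟙 _ := by
  -- The universal element of `γ₁ (γ₂ 1)` lifts along some member of `S`; the transpose of the lift
  -- is the section.
  obtain ⟨i, b, hb⟩ := exists_apply_eq_of_hom_ext
    (fun i : Σ (Z : Sheaf K (Type w)), {k : Z ⟶ γ₂.obj PUnit.{w + 1} // S k} => γ₁.map i.2.1)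
    (fun g h H => (adj₁.homEquiv _ _).injective
      (hom_ext_of_mem_locallySurjectiveTopology hS fun Z k hk => by
        rw [← adj₁.homEquiv_naturality_left, ← adj₁.homEquiv_naturality_left]
        exact congrArg _ (H ⟨Z, k, hk⟩)))
    (adj₂.unit.app PUnit.{w + 1} PUnit.unit)
  refine ⟨i.1, i.2.1, (adj₂.homEquiv _ _).symm (↾fun _ => b), i.2.2, ?_⟩
  refine (adj₂.homEquiv _ _).injective ?_
  rw [adj₂.homEquiv_naturality_right, Equiv.apply_symm_apply, adj₂.homEquiv_id]
  ext
  exact hb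

/-- The connected objects generating a completely connected topos: the object corepresenting `γ₁`
and the connected components of the sheafified representables. -/
noncomputable def connectedGenerator :
    Option (Σ d : D, γ₁.obj ((sheafifiedYoneda K).obj d)) → Sheaf K (Type w)
  | none => γ₂.obj PUnit.{w + 1}
  | some i => component adj₁ ((sheafifiedYoneda K).obj i.1) i.2

end ConnectedSite

/-- A completely connected topos of sheaves has a completely connected site. -/
lemma exists_isCompletelyConnectedSite {D : Type w} [SmallCategory D] {K : GrothendieckTopology D}
    (h : IsCompletelyConnected.{w} (Sheaf K (Type w))) :
    ∃ (C : Type w) (_ : SmallCategory C) (J : GrothendieckTopology C),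
      IsCompletelyConnectedSite J ∧ Nonempty (Sheaf K (Type w) ≌ Sheaf J (Type w)) := by
  obtain ⟨γ₂, γ₁, γ₀, Γ, -, ⟨adj₂⟩, ⟨adj₁⟩, ⟨adj₀⟩⟩ := h
  have := isIso_counit_of_adjoint_string adj₂ adj₁ adj₀
  let F := inducedFunctor (connectedGenerator (γ₂ := γ₂) adj₁)
  have hF : F.IsCoverDense (locallySurjectiveTopology K) := ⟨fun X d x => by
    refine K.superset_covering ?_ (ofArrows_component_mem adj₁ adj₀ _ d (𝟙 _))
    rintro d' f ⟨Z, p, q, ⟨a⟩, hpq⟩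
    refine ⟨⟨some ⟨d, a⟩, p, pullback.fst _ _ ≫ x, ?_⟩⟩
    rw [Category.comp_id] at hpq
    rw [← hpq, Category.assoc]
    rfl⟩
  have hunique (i) : Nonempty (Unique (γ₁.obj (connectedGenerator (γ₂ := γ₂) adj₁ i))) :=
    match i with
    | none => nonempty_unique_map_leftAdjoint_punit adj₂ adj₁
    | some i => nonempty_unique_map_component adj₂ adj₁ _ i.2
  refine ⟨InducedCategory _ (connectedGenerator (γ₂ := γ₂) adj₁), inferInstance,
    F.inducedTopology (locallySurjectiveTopology K), ⟨none, ⟨?_⟩, ?_⟩,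
    ⟨sheafEquivOfIsCoverDense F⟩⟩
  · refine IsInitial.ofUniqueHom (fun i => InducedCategory.homMk
      ((adj₂.homEquiv _ _).symm (↾fun _ => (hunique i).some.default))) fun i m => ?_
    refine F.map_injective ((adj₂.homEquiv _ _).injective ?_)
    have := (hunique i).some
    ext
    exact Subsingleton.elim (α := γ₁.obj (connectedGenerator adj₁ i)) _ _
  · intro S hS
    rw [Functor.mem_inducedTopology_iff_of_isCoverDense] at hS
    obtain ⟨Z, k, s, ⟨i, g, t, hg, rfl⟩, hs⟩ :=
      exists_section_of_mem_locallySurjectiveTopology adj₂ adj₁ hS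
    rw [← Sieve.id_mem_iff_eq_top]
    let P : InducedCategory _ (connectedGenerator (γ₂ := γ₂) adj₁) := none
    -- The split epimorphism factors through some `g` in `S`, so `g` itself splits and the identity
    -- lies in `S`.
    let l : P ⟶ i := F.preimage (s ≫ t : γ₂.obj PUnit.{w + 1} ⟶ F.obj i)
    have hl : l ≫ g = 𝟙 _ := F.map_injective (by
      rw [F.map_comp, show F.map l = s ≫ t from F.map_preimage _, F.map_id]
      exact (Category.assoc _ _ _).trans hs)
    exact hl ▸ S.downward_closed hg l

theorem mainTheorem1 {E : Type u} [Category.{w} E] (hE : IsGrothendieckTopos.{w, u} E) :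
    IsCompletelyConnected.{w, u} E ↔
      ∃ (C : Type w) (_ : SmallCategory C) (J : GrothendieckTopology C),
        IsCompletelyConnectedSite J ∧ Nonempty (E ≌ Sheaf J (Type w)) := by
  constructor
  · intro h
    obtain ⟨D, _, K, ⟨e⟩⟩ := hE
    obtain ⟨C, _, J, hJ, ⟨e'⟩⟩ := exists_isCompletelyConnectedSite (h.of_equivalence e.symm)
    exact ⟨C, _, J, hJ, ⟨e.trans e'⟩⟩
  · rintro ⟨C, _, J, hJ, ⟨e⟩⟩
    exact (isCompletelyConnected_sheaf hJ).of_equivalence e
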